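/- Let $\mathcal T=(S,\kappa,\mathrm{AP},\mathcal L)$ be a labelled denumerable Markov chain: $S$ is a countable set with the $\sigma$-algebra $2^S$, $\kappa$ is a Markov kernel on $S$, $\mathrm{AP}$ is a finite set and $\mathcal L:S\to 2^{\mathrm{AP}}$. Let $\mathcal M=(Q,q_0,E,\mathcal F)$ be a deterministic and complete Muller automaton over $\mathrm{AP}$: $Q$ is finite, $q_0\in Q$, $\mathcal F\subseteq 2^Q$, and $E\subseteq Q\times 2^{\mathrm{AP}}\times Q$ contains, for all $q\in Q$ and $u\subseteq \mathrm{AP}$, exactly one edge $(q,u,q')$. The product $\mathcal T\ltimes\mathcal M$ is the Markov chain on $S\times Q$ with $\kappa'((s,q),A\times\{q'\})=\kappa(s,A)$ if $(q,\mathcal L(s),q')\in E$ and $0$ otherwise, in which $(s,q)$ is labelled by $q$. For a Markov chain on a countable set $X$ and a distribution $\nu$ on $X$, let $\mathrm{Prob}_\nu$ be the induced probability measure on the infinite paths with initial distribution $\nu$, and for $D\subseteq X$ let $\mathbf F D$ be the event that $D$ is eventually visited; $D$ is an attractor if $\mathrm{Prob}_\nu(\mathbf F D)=1$ for every distribution $\nu$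 on $X$. For $B\subseteq S\times Q$, let $\mathsf{Graph}(B)$ be the directed graph with vertex set $B$ and an edge from $x$ to $y$ whenever there is a finite path from $x$ to $y$ in $\mathcal T\ltimes\mathcal M$ all of whose steps have positive probability. A bottom strongly connected component (BSCC) of a directed graph is a strongly connected component that no edge leaves. A BSCC $C$ of $\mathsf{Graph}(B)$ is good, written $C\in\mathsf{Good}^B(\mathcal F)$, if there is $F\in\mathcal F$ such that (a) whenever some $(s,q)$ is reachable from $C$ by such a path, then $q\in F$, and (b) for every $q\in F$ there is $s\in S$ such that $(s,q)$ is reachable from $C$ by such a path. Assume that $\mathcal T$ has a finite attractor. Then $\mathcal T\ltimes\mathcal M$ has a finite attractor, and for every attractor $B$ of $\mathcal T\ltimes\mathcal M$ and every distribution $\mu$ on $S$, \[ \mathrm{Prob}^{\mathcal T\ltimes\mathcal M}_{\mu\times\delta_{q_0}}(\mathsf{Inf}\in\mathcal F)=\sum_{C\in\mathsf{Good}^B(\mathcal F)}\mathrm{Prob}^{\mathcal T\ltimes\mathcal M}_{\mu\times\delta_{q_0}}(\mathbf F C), \] where $\mathsf{Inf}\in\mathcal F$ is the event that the set of locations $q\in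 Q$ visited infinitely often belongs to $\mathcal F$. -/

import Mathlib

open MeasureTheory ProbabilityTheory
open scoped ENNReal

noncomputable section

/-- A labelled stochastic transition system on the measurable space `S`: a Markov kernel on `S`
together with a measurable labelling of the states by sets of atomic propositions. -/
structure LSTS (S AP : Type*) [MeasurableSpace S] where
  kernel : Kernel S S
  isMarkov : IsMarkovKernel kernel
  label : S → Set AP
  measurable_label : Measurable label

namespace LSTS

variable {S AP : Type*} [MeasurableSpace S] (T : LSTS S AP)

instance : IsMarkovKernel T.kernel := T.isMarkov

/-- The kernel giving the law of the state at time `n + 1` from the history up to time `n`: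
it only looks at the state at time `n`. -/
def historyKernel (n : ℕ) : Kernel (Finset.Iic n → S) S :=
  T.kernel.comap (fun h => h ⟨n, Finset.mem_Iic.mpr le_rfl⟩) (measurable_pi_apply _)

instance (n : ℕ) : IsMarkovKernel (T.historyKernel n) := by
  unfold historyKernel; infer_instance

/-- The probability measure on infinite paths with initial distribution `μ`. -/
def prob (μ : Measure S) : Measure (ℕ → S) :=
  Kernel.trajMeasure (X := fun _ => S) μ T.historyKernel

/-- The set of infinite paths that eventually visit `B`. -/
def eventually (B : Set S) : Set (ℕ → S) := {ρ | ∃ n, ρ n ∈ B}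

/-- The atomic propositions that hold infinitely often along a path. -/
def inf (ρ : ℕ → S) : Set AP := {a | {j : ℕ | a ∈ T.label (ρ j)}.Infinite}

/-- The set of infinite paths that satisfy the Muller condition `𝓕`. -/
def muller (𝓕 : Set (Set AP)) : Set (ℕ → S) := {ρ | T.inf ρ ∈ 𝓕}

/-- `B` is almost surely reached from every initial distribution. -/
def IsAttractor (B : Set S) : Prop :=
  MeasurableSet B ∧
    ∀ μ : Measure S, IsProbabilityMeasure μ → T.prob μ (eventually B) = 1

/-- There is a finite path from `x` to `y`, each of whose steps has positive probability. -/
def Reach (x y : S) : Prop :=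
  Relation.ReflTransGen (fun s t => 0 < T.kernel s {t}) x y

/-- The graph of `B`: its vertices are the states in `B`, and there is an edge from `x` to `y`
if there is a path from `x` to `y` in the transition system (possibly leaving `B`). -/
def graph (B : Set S) : Digraph B where
  Adj x y := T.Reach x y

end LSTS

/-- `C` is a strongly connected component of the directed graph `G`. -/
def Digraph.IsSCC {V : Type*} (G : Digraph V) (C : Set V) : Prop :=
  C.Nonempty ∧ ∀ x ∈ C, ∀ y,
    y ∈ C ↔ Relation.ReflTransGen G.Adj x y ∧ Relation.ReflTransGen G.Adj y x

/-- `C` is a bottom strongly connected component of `G`: one that no edge leaves. -/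
def Digraph.IsBSCC {V : Type*} (G : Digraph V) (C : Set V) : Prop :=
  G.IsSCC C ∧ ∀ x ∈ C, ∀ y, G.Adj x y → y ∈ C

/-- A deterministic and complete Muller automaton over `AP` with set of locations `Q`. -/
structure DMA (AP Q : Type*) where
  init : Q
  edges : Set (Q × Set AP × Q)
  acc : Set (Set Q)
  deterministic : ∀ q u q₁ q₂, (q, u, q₁) ∈ edges → (q, u, q₂) ∈ edges → q₁ = q₂
  complete : ∀ q u, ∃ q', (q, u, q') ∈ edges

namespace DMA

variable {AP Q : Type*} (M : DMA AP Q)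

/-- The unique location reached from `q` by reading `u`. -/
def next (q : Q) (u : Set AP) : Q := (M.complete q u).choose

theorem next_eq_iff (q : Q) (u : Set AP) (q' : Q) : M.next q u = q' ↔ (q, u, q') ∈ M.edges :=
  ⟨fun h => h ▸ (M.complete q u).choose_spec,
    fun h => M.deterministic q u _ _ (M.complete q u).choose_spec h⟩

end DMA

namespace LSTS

variable {S AP Q : Type*} [MeasurableSpace S] [Finite AP]
  [Finite Q] [MeasurableSpace Q] [DiscreteMeasurableSpace Q]

theorem measurable_next (T : LSTS S AP) (M : DMA AP Q) :
    Measurable fun x : S × Q => M.next x.2 (T.label x.1) := by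
  have h : Measurable fun p : Q × Set AP => M.next p.1 p.2 := measurable_of_countable _
  exact h.comp (measurable_snd.prodMk (T.measurable_label.comp measurable_fst))

/-- The product of `T` with `M`: from `(s, q)` the first component moves according to the kernel
of `T`, the second one moves to the location reached from `q` by reading the label of `s`. The
atomic propositions of the product are the locations of `M`, and `(s, q)` is labelled by `q`. -/
def product (T : LSTS S AP) (M : DMA AP Q) : LSTS (S × Q) Q where
  kernel := (T.kernel.comap Prod.fst measurable_fst) ×ₖ
    (Kernel.deterministic (fun x : S × Q => M.next x.2 (T.label x.1)) (T.measurable_next M))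
  isMarkov := inferInstance
  label x := {x.2}
  measurable_label := by
    have h : Measurable fun q : Q => ({q} : Set Q) := Measurable.of_discrete
    exact h.comp measurable_snd

open scoped Classical in
theorem product_kernel_apply (T : LSTS S AP) (M : DMA AP Q) (s : S) (q q' : Q) {A : Set S} :
    (T.product M).kernel (s, q) (A ×ˢ {q'}) =
      if (q, T.label s, q') ∈ M.edges then T.kernel s A else 0 := by
  simp only [product, Kernel.prod_apply, Measure.prod_prod, Kernel.comap_apply,
    Kernel.deterministic_apply, ← M.next_eq_iff]
  by_cases h : M.next q (T.label s) = q' <;> simp [h]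

/-- The bottom strongly connected component `C` of the graph of `B` (in the product of `T` with
`M`) is good for the acceptance condition of `M`. -/
def IsGood (T : LSTS S AP) (M : DMA AP Q) {B : Set (S × Q)} (C : Set B) : Prop :=
  ((T.product M).graph B).IsBSCC C ∧
    ∃ F ∈ M.acc,
      (∀ s q, (∃ c ∈ C, (T.product M).Reach c (s, q)) → q ∈ F) ∧
      ∀ q ∈ F, ∃ s, ∃ c ∈ C, (T.product M).Reach c (s, q)

end LSTS

end

open Filter Preorder

namespace ProbabilityTheory

/-! Let `A` be a finite attractor of `T`. The first component of the product chain is a chain of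
`T`, so almost every product path meets the finite set `A × Q` infinitely often and, by pigeonhole,
some state `a` infinitely often. Lévy's conditional Borel–Cantelli lemma propagates this to
everything reachable from `a` (`ae_frequently_succ`, `ae_isRecurrentPath`). The rest is
deterministic. Along such a path, states reachable from `a` lead back to `a`, so the reachable
locations are exactly those visited infinitely often (`inf_eq`), and the part of `B` reachable from
`a` is the only BSCC visited (`eq_of_mem_eventually`); it is good iff the path is accepting
(`isGood_iff`). Up to a null set, the Muller event is thus a countable disjoint union of the events
`eventually C`. -/

theorem compProd_map_prodMap {α β γ δ : Type*} [MeasurableSpace α] [MeasurableSpace β]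
    [MeasurableSpace γ] [MeasurableSpace δ] (ν : Measure α) [SFinite ν]
    (K : Kernel α β) [IsSFiniteKernel K] (L : Kernel γ δ) [IsSFiniteKernel L]
    {h : α → γ} (hh : Measurable h) {f : β → δ} (hf : Measurable f)
    (hKL : K.map f = L.comap h hh) :
    (ν ⊗ₘ K).map (Prod.map h f) = ν.map h ⊗ₘ L := by
  have hfac : Prod.map h f = Prod.map h id ∘ Prod.map id f := rfl
  rw [hfac, ← Measure.map_map (by fun_prop) (by fun_prop), ← Measure.compProd_map hf, hKL]
  ext s hs
  rw [Measure.map_apply (by fun_prop) hs,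
    Measure.compProd_apply (hs.preimage (by fun_prop)), Measure.compProd_apply hs,
    lintegral_map (Kernel.measurable_kernel_prodMk_left hs) hh]
  rfl

end ProbabilityTheory

namespace LSTS

/-! ### Path measures and their images under maps intertwining kernels -/

section General

variable {S AP : Type*} [MeasurableSpace S] (T : LSTS S AP)

instance (μ : Measure S) [IsProbabilityMeasure μ] : IsProbabilityMeasure (T.prob μ) := by
  unfold prob; infer_instance

theorem map_prob_eval_zero (μ : Measure S) : (T.prob μ).map (fun ρ => ρ 0) = μ := by
  have hfac : (fun ρ : ℕ → S => ρ 0) =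
      (fun h : Finset.Iic 0 → S => h ⟨0, by simp⟩) ∘ frestrictLe 0 := rfl
  rw [hfac, ← Measure.map_map (by fun_prop) (by fun_prop), prob, Kernel.trajMeasure,
    Measure.map_comp _ _ (by fun_prop), Kernel.traj_map_frestrictLe, Kernel.partialTraj_self,
    Measure.id_comp, Measure.map_map (by fun_prop) (by fun_prop)]
  exact Measure.map_id

theorem map_prob_history (μ : Measure S) [IsProbabilityMeasure μ] (n : ℕ) :
    (T.prob μ).map (fun ρ => (frestrictLe n ρ, ρ (n + 1))) =
      (T.prob μ).map (frestrictLe n) ⊗ₘ T.historyKernel n :=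
  Kernel.map_frestrictLe_trajMeasure_compProd_eq_map_trajMeasure.symm

/-- The path measure is determined by its initial distribution and its one-step conditional
laws. -/
theorem eq_prob_of_history {μ : Measure S} [IsProbabilityMeasure μ] (P : Measure (ℕ → S))
    [IsProbabilityMeasure P] (h0 : P.map (fun ρ => ρ 0) = μ)
    (hstep : ∀ n, P.map (fun ρ => (frestrictLe n ρ, ρ (n + 1))) =
      P.map (frestrictLe n) ⊗ₘ T.historyKernel n) :
    P = T.prob μ := by
  have key : ∀ n, P.map (frestrictLe (π := fun _ => S) n) = (T.prob μ).map (frestrictLe n) := by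
    intro n
    induction n with
    | zero =>
      have hfac : frestrictLe (π := fun _ => S) 0 =
          (fun (s : S) (_ : Finset.Iic 0) => s) ∘ (fun ρ => ρ 0) := by
        ext ρ ⟨i, hi⟩
        obtain rfl : i = 0 := by simpa using hi
        rfl
      have hm : Measurable (fun (s : S) (_ : Finset.Iic 0) => s) := by fun_prop
      rw [hfac, ← Measure.map_map hm (by fun_prop), ← Measure.map_map hm (by fun_prop), h0,
        T.map_prob_eval_zero μ]
    | succ n ih =>
      let g : (Finset.Iic n → S) × S → (Finset.Iic (n + 1) → S) := fun p i =>
        if hi : i.1 ≤ n then p.1 ⟨i.1, Finset.mem_Iic.2 hi⟩ else p.2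
      have hg : Measurable g := by
        refine measurable_pi_lambda _ fun i => ?_
        by_cases hi : i.1 ≤ n
        · simp only [g, hi, dite_true]; fun_prop
        · simp only [g, hi, dite_false]; fun_prop
      have hfac : frestrictLe (π := fun _ => S) (n + 1) =
          g ∘ (fun ρ => (frestrictLe n ρ, ρ (n + 1))) := by
        ext ρ ⟨i, hi⟩
        by_cases h : i ≤ n
        · simp [g, h]
        · obtain rfl : i = n + 1 := by simp at hi; omega
          simp [g]
      rw [hfac, ← Measure.map_map hg (by fun_prop), ← Measure.map_map hg (by fun_prop), hstep,
        T.map_prob_history, ih]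
  refine ext_of_generate_finite _ (generateFrom_measurableCylinders (α := fun _ : ℕ => S)).symm
    isPiSystem_measurableCylinders (fun s hs => ?_) (by simp)
  obtain ⟨N, t, ht, rfl⟩ : ∃ N t, MeasurableSet t ∧ s = cylinder (Finset.Iic N) t := by
    simpa [measurableCylinders_nat] using hs
  have := congrArg (fun m => m t) (key N)
  rw [Measure.map_apply (measurable_frestrictLe N) ht,
    Measure.map_apply (measurable_frestrictLe N) ht] at this
  exact this

/-- The image of a Markov chain, observed from time `k` on, under a map that intertwines the
kernels is again a Markov chain. -/
theorem map_prob {S' AP' : Type*} [MeasurableSpace S'] (T' : LSTS S' AP') {f : S → S'}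
    (hf : Measurable f) (hker : T.kernel.map f = T'.kernel.comap f hf)
    (μ : Measure S) [IsProbabilityMeasure μ] (k : ℕ) :
    (T.prob μ).map (fun ρ n => f (ρ (n + k))) =
      T'.prob ((T.prob μ).map (fun ρ => f (ρ k))) := by
  have hm : Measurable (fun (ρ : ℕ → S) (n : ℕ) => f (ρ (n + k))) := by fun_prop
  have hmk : Measurable (fun (ρ : ℕ → S) => f (ρ k)) := by fun_prop
  have : IsProbabilityMeasure ((T.prob μ).map (fun ρ n => f (ρ (n + k)))) :=
    Measure.isProbabilityMeasure_map hm.aemeasurable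
  have : IsProbabilityMeasure ((T.prob μ).map (fun ρ => f (ρ k))) :=
    Measure.isProbabilityMeasure_map hmk.aemeasurable
  refine T'.eq_prob_of_history _ ?_ fun n => ?_
  · rw [Measure.map_map (by fun_prop) hm]
    simp [Function.comp_def]
  · let h : (Finset.Iic (n + k) → S) → (Finset.Iic n → S') := fun x i =>
      f (x ⟨i.1 + k, by have := Finset.mem_Iic.1 i.2; simpa using this⟩)
    have hh : Measurable h := by fun_prop
    have hKL : (T.historyKernel (n + k)).map f = (T'.historyKernel n).comap h hh := by
      ext x : 1
      have := DFunLike.congr_fun hker (x ⟨n + k, by simp⟩)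
      rw [Kernel.map_apply _ hf, Kernel.comap_apply] at this
      rw [Kernel.map_apply _ hf, Kernel.comap_apply, historyKernel, historyKernel,
        Kernel.comap_apply, Kernel.comap_apply, this]
    have e1 : (fun ρ : ℕ → S' => (frestrictLe (π := fun _ => S') n ρ, ρ (n + 1))) ∘
        (fun (ρ : ℕ → S) (n : ℕ) => f (ρ (n + k))) =
        Prod.map h f ∘ fun ρ => (frestrictLe (n + k) ρ, ρ (n + k + 1)) := by
      funext ρ
      simp only [Function.comp_apply, Prod.map, Nat.add_right_comm n 1 k]
      rfl
    have e2 : frestrictLe (π := fun _ => S') n ∘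
        (fun (ρ : ℕ → S) (n : ℕ) => f (ρ (n + k))) = h ∘ frestrictLe (n + k) := rfl
    rw [Measure.map_map (by fun_prop) hm, Measure.map_map (by fun_prop) hm, e1, e2,
      ← Measure.map_map (by fun_prop) (by fun_prop), map_prob_history,
      compProd_map_prodMap _ _ _ hh hf hKL, Measure.map_map hh (by fun_prop)]

theorem measurableSet_eventually {B : Set S} (hB : MeasurableSet B) :
    MeasurableSet (eventually B) := by
  have : eventually B = ⋃ n, (fun ρ : ℕ → S => ρ n) ⁻¹' B := by
    ext ρ; simp [eventually]
  rw [this]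
  exact MeasurableSet.iUnion fun n => hB.preimage (measurable_pi_apply n)

/-- For each `k`, the image under `f` of the path from time `k` on is again a chain of `T'`. An
attractor is hit from every initial law, in particular from that of `f (ρ k)`, so a visit occurs
after every time `k`. -/
theorem IsAttractor.ae_frequently_mem {S' AP' : Type*} [MeasurableSpace S'] {T' : LSTS S' AP'}
    {A : Set S'} (hA : T'.IsAttractor A) {f : S → S'}
    (hf : Measurable f) (hker : T.kernel.map f = T'.kernel.comap f hf)
    (μ : Measure S) [IsProbabilityMeasure μ] :
    ∀ᵐ ρ ∂T.prob μ, ∃ᶠ n in atTop, f (ρ n) ∈ A := by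
  have h : ∀ k, ∀ᵐ ρ ∂T.prob μ, ∃ n, f (ρ (n + k)) ∈ A := by
    intro k
    have hm : Measurable (fun (ρ : ℕ → S) (n : ℕ) => f (ρ (n + k))) := by fun_prop
    have hmk : Measurable (fun (ρ : ℕ → S) => f (ρ k)) := by fun_prop
    have := hA.2 _ (Measure.isProbabilityMeasure_map (μ := T.prob μ) hmk.aemeasurable)
    rw [← T.map_prob T' hf hker μ k, Measure.map_apply hm (measurableSet_eventually hA.1)] at this
    exact (mem_ae_iff_prob_eq_one ((measurableSet_eventually hA.1).preimage hm)).2 this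
  filter_upwards [ae_all_iff.2 h] with ρ hρ
  refine frequently_atTop.2 fun k => ?_
  obtain ⟨n, hn⟩ := hρ k
  exact ⟨n + k, by omega, hn⟩

end General

/-! ### Almost sure recurrence on a countable state space -/

section Countable

variable {S AP : Type*} [Countable S] [MeasurableSpace S] [DiscreteMeasurableSpace S]
  (T : LSTS S AP)

theorem ae_kernel_pos (μ : Measure S) [IsProbabilityMeasure μ] :
    ∀ᵐ ρ ∂T.prob μ, ∀ n, 0 < T.kernel (ρ n) {ρ (n + 1)} := by
  refine ae_all_iff.2 fun n => ?_
  let s : Set ((Finset.Iic n → S) × S) :=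
    {p | 0 < T.kernel (p.1 ⟨n, Finset.mem_Iic.2 le_rfl⟩) {p.2}}
  have hs : MeasurableSet s := by
    have hm : Measurable fun p : S × S => T.kernel p.1 {p.2} := measurable_of_countable _
    have hp : Measurable fun p : (Finset.Iic n → S) × S =>
        (p.1 ⟨n, Finset.mem_Iic.2 le_rfl⟩, p.2) := by fun_prop
    exact measurableSet_lt measurable_const (hm.comp hp)
  have h : ∀ᵐ p ∂(T.prob μ).map (fun ρ => (frestrictLe n ρ, ρ (n + 1))), p ∈ s := by
    rw [map_prob_history]
    refine (Measure.ae_compProd_iff hs).2 (Eventually.of_forall fun x => ?_)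
    refine (ae_iff_of_countable).2 fun t ht => ?_
    exact pos_iff_ne_zero.2 ht
  exact ae_of_ae_map (p := fun p => p ∈ s) (by fun_prop) h

theorem condExp_indicator_succ (μ : Measure S) [IsProbabilityMeasure μ] (n : ℕ) (b : S) :
    (T.prob μ)[((fun ρ : ℕ → S => ρ (n + 1)) ⁻¹' {b}).indicator (fun _ => (1 : ℝ)) |
      Filtration.piLE (X := fun _ => S) n] =ᵐ[T.prob μ]
      fun ρ => (T.kernel (ρ n)).real {b} := by
  have : Nonempty S := nonempty_of_isProbabilityMeasure μ
  have hres : Measurable (frestrictLe (π := fun _ => S) n) := measurable_frestrictLe n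
  have h1 := condDistrib_ae_eq_condExp (μ := T.prob μ) (X := frestrictLe (π := fun _ => S) n)
    (Y := fun ρ => ρ (n + 1)) hres (measurable_pi_apply _) (measurableSet_singleton b)
  have h2 := ae_of_ae_map hres.aemeasurable
    (Kernel.condDistrib_trajMeasure (X := fun _ => S) (μ₀ := μ) (κ := T.historyKernel) (a := n))
  rw [Filtration.piLE_eq_comap_frestrictLe]
  filter_upwards [h1, h2] with ρ h1 h2
  rw [← h1]
  exact congrArg (fun m : Measure S => m.real {b}) h2

/-- A successor of a state that is visited infinitely often is visited infinitely often. -/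
theorem ae_frequently_succ (μ : Measure S) [IsProbabilityMeasure μ] :
    ∀ᵐ ρ ∂T.prob μ, ∀ a b, 0 < T.kernel a {b} →
      (∃ᶠ n in atTop, ρ n = a) → ∃ᶠ n in atTop, ρ n = b := by
  refine ae_all_iff.2 fun a => ae_all_iff.2 fun b => ?_
  let s : ℕ → Set (ℕ → S) := fun n => (fun ρ => ρ n) ⁻¹' {b}
  have hs : ∀ n, MeasurableSet[Filtration.piLE (X := fun _ => S) n] (s n) := by
    intro n
    rw [Filtration.piLE_eq_comap_frestrictLe]
    exact ⟨(fun h : Finset.Iic n → S => h ⟨n, Finset.mem_Iic.2 le_rfl⟩) ⁻¹' {b},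
      (measurableSet_singleton b).preimage (measurable_pi_apply _), rfl⟩
  -- Lévy's lemma: `b` is visited infinitely often iff its conditional probabilities given the past
  -- sum to infinity. Each visit to `a` contributes the fixed positive amount `T.kernel a {b}`.
  filter_upwards [ae_mem_limsup_atTop_iff (T.prob μ) hs,
    ae_all_iff.2 fun n => T.condExp_indicator_succ μ n b] with ρ hlim hcond hab ha
  have hmem : ρ ∈ limsup s atTop := by
    refine hlim.2 ?_
    have hdiv := (Set.limsup_eq_tendsto_sum_indicator_atTop
      (ENNReal.toReal_pos hab.ne' (measure_ne_top _ _))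
      (fun n => (fun ρ : ℕ → S => ρ n) ⁻¹' {a})).subset
      (show ρ ∈ limsup (fun n => (fun ρ : ℕ → S => ρ n) ⁻¹' {a}) atTop from
        mem_limsup_iff_frequently_mem.2 ha)
    refine tendsto_atTop_mono (fun n => Finset.sum_le_sum fun k _ => ?_) hdiv
    refine le_of_le_of_eq ?_ (hcond k).symm
    by_cases hk : ρ k = a
    · rw [Set.indicator_of_mem (by exact hk), hk]; exact le_rfl
    · rw [Set.indicator_of_notMem (by exact hk)]; exact measureReal_nonneg
  have hfreq : ∃ᶠ n in atTop, ρ ∈ s n := mem_limsup_iff_frequently_mem.1 hmem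
  exact hfreq

/-- The steps of `ρ` have positive probability, and `ρ` visits infinitely often every state that
can be reached from `a`. -/
def IsRecurrentPath (a : S) (ρ : ℕ → S) : Prop :=
  (∀ n, 0 < T.kernel (ρ n) {ρ (n + 1)}) ∧ ∀ b, T.Reach a b → ∃ᶠ n in atTop, ρ n = b

theorem ae_isRecurrentPath (μ : Measure S) [IsProbabilityMeasure μ] {A : Set S} (hA : A.Finite)
    (hio : ∀ᵐ ρ ∂T.prob μ, ∃ᶠ n in atTop, ρ n ∈ A) :
    ∀ᵐ ρ ∂T.prob μ, ∃ a, T.IsRecurrentPath a ρ := by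
  filter_upwards [hio, T.ae_kernel_pos μ, T.ae_frequently_succ μ] with ρ hρ hpos hsucc
  obtain ⟨a, -, ha⟩ : ∃ a ∈ A, ∃ᶠ n in atTop, ρ n = a := by
    by_contra! hcon
    refine hρ ?_
    have := (eventually_all_finite (l := atTop) (p := fun a n => ¬ ρ n = a) hA).2
      hcon
    exact this.mono fun n hn hmem => hn _ hmem rfl
  refine ⟨a, hpos, fun b hb => ?_⟩
  induction hb with
  | refl => exact ha
  | tail _ hbc ih => exact hsucc _ _ hbc ih

end Countable

/-! ### Recurrent paths and the components of the graph -/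

section Paths

variable {S AP : Type*} [MeasurableSpace S] {T : LSTS S AP}

theorem reach_of_le {ρ : ℕ → S} (hρ : ∀ n, 0 < T.kernel (ρ n) {ρ (n + 1)}) {m n : ℕ}
    (h : m ≤ n) : T.Reach (ρ m) (ρ n) := by
  induction n, h using Nat.le_induction with
  | base => exact Relation.ReflTransGen.refl
  | succ n _ ih => exact ih.tail (hρ n)

theorem reach_of_reflTransGen_graph {B : Set S} {x y : B}
    (h : Relation.ReflTransGen (T.graph B).Adj x y) : T.Reach x y := by
  induction h with
  | refl => exact Relation.ReflTransGen.refl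
  | tail _ hbc ih => exact ih.trans hbc

/-- From the Dirac mass at `a`, almost every path hits `B` using only steps of positive probability,
so at least one such path exists. -/
theorem IsAttractor.exists_reach [Countable S] [DiscreteMeasurableSpace S] {B : Set S}
    (hB : T.IsAttractor B) (a : S) : ∃ b ∈ B, T.Reach a b := by
  have h0 : ∀ᵐ ρ ∂T.prob (Measure.dirac a), ρ 0 = a := by
    refine ae_of_ae_map (f := fun ρ : ℕ → S => ρ 0) (p := fun x => x = a)
      (measurable_pi_apply 0).aemeasurable ?_
    rw [map_prob_eval_zero, ae_dirac_eq]
    exact rfl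
  have hB' := (mem_ae_iff_prob_eq_one (measurableSet_eventually hB.1)).2
    (hB.2 (Measure.dirac a) inferInstance)
  obtain ⟨ρ, ⟨h0, n, hn⟩, hpos⟩ := ((h0.and hB').and (T.ae_kernel_pos (Measure.dirac a))).exists
  exact ⟨ρ n, hn, h0 ▸ reach_of_le hpos n.zero_le⟩

namespace IsRecurrentPath

variable {a : S} {ρ : ℕ → S}

theorem reach (hρ : T.IsRecurrentPath a ρ) (n : ℕ) : T.Reach (ρ n) a := by
  obtain ⟨m, hm, rfl⟩ := frequently_atTop.1 (hρ.2 a Relation.ReflTransGen.refl) n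
  exact reach_of_le hρ.1 hm

theorem reach_symm (hρ : T.IsRecurrentPath a ρ) {b : S} (hb : T.Reach a b) : T.Reach b a := by
  obtain ⟨n, rfl⟩ := (hρ.2 b hb).exists
  exact hρ.reach n

theorem isBSCC (hρ : T.IsRecurrentPath a ρ) {B : Set S} (hne : ∃ b ∈ B, T.Reach a b) :
    (T.graph B).IsBSCC {x | T.Reach a x} := by
  obtain ⟨b, hb, hab⟩ := hne
  refine ⟨⟨⟨⟨b, hb⟩, hab⟩, fun x hx y => ⟨fun hy => ?_, fun h => ?_⟩⟩, fun x hx y hxy => ?_⟩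
  · exact ⟨.single ((hρ.reach_symm hx).trans hy), .single ((hρ.reach_symm hy).trans hx)⟩
  · exact Relation.ReflTransGen.trans hx (reach_of_reflTransGen_graph h.1)
  · exact Relation.ReflTransGen.trans hx hxy

theorem mem_eventually (hρ : T.IsRecurrentPath a ρ) {B : Set S}
    (hne : ∃ b ∈ B, T.Reach a b) :
    ρ ∈ eventually (Subtype.val '' {x : B | T.Reach a x}) := by
  obtain ⟨b, hb, hab⟩ := hne
  obtain ⟨n, rfl⟩ := (hρ.2 b hab).exists
  exact ⟨n, ⟨_, hb⟩, hab, rfl⟩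

/-- A recurrent path visits only one bottom strongly connected component. -/
theorem eq_of_mem_eventually (hρ : T.IsRecurrentPath a ρ) {B : Set S}
    (hne : ∃ b ∈ B, T.Reach a b) {C : Set B} (hC : (T.graph B).IsBSCC C)
    (hmem : ρ ∈ eventually (Subtype.val '' C)) : C = {x : B | T.Reach a x} := by
  obtain ⟨b, hb, hab⟩ := hne
  obtain ⟨n, c, hc, hcn⟩ := hmem
  -- After meeting `C` the path returns to `a`, from which `b` is reachable; as `C` is bottom, it
  -- contains `b`.
  have hca : T.Reach c a := hcn ▸ hρ.reach n
  have hbC : (⟨b, hb⟩ : B) ∈ C := hC.2 c hc _ (hca.trans hab)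
  have hbc : T.Reach b c := reach_of_reflTransGen_graph ((hC.1.2 _ hbC c).1 hc).1
  ext x
  refine ⟨fun hx => ?_, fun hx => hC.2 c hc x (hca.trans hx)⟩
  exact (hab.trans hbc).trans (reach_of_reflTransGen_graph ((hC.1.2 c hc x).1 hx).1)

end IsRecurrentPath

/-- A component is determined by any one of its vertices, so choosing a vertex in each is injective.
-/
theorem countable_isBSCC {V : Type*} [Countable V] (G : Digraph V) :
    {C | G.IsBSCC C}.Countable := by
  have : Function.Injective fun C : {C | G.IsBSCC C} => C.2.1.1.some := by
    intro C D hCD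
    have hC := C.2.1.1.some_mem
    have hD := D.2.1.1.some_mem
    simp only at hCD
    rw [← hCD] at hD
    ext y
    rw [C.2.1.2 _ hC y, D.2.1.2 _ hD y]
  exact Set.countable_coe_iff.1 this.countable

end Paths

/-! ### Muller acceptance in the product -/

section Product

variable {S AP Q : Type*} [MeasurableSpace S] [Finite AP]
  [Finite Q] [MeasurableSpace Q] [DiscreteMeasurableSpace Q] (T : LSTS S AP) (M : DMA AP Q)

theorem map_fst_product_kernel :
    (T.product M).kernel.map Prod.fst = T.kernel.comap Prod.fst measurable_fst := by
  have := Kernel.fst_prod (T.kernel.comap Prod.fst measurable_fst)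
    (Kernel.deterministic (fun x : S × Q => M.next x.2 (T.label x.1)) (T.measurable_next M))
  rwa [Kernel.fst_eq] at this

variable {T M}

theorem IsAttractor.prod_univ {A : Set S} (hA : T.IsAttractor A) :
    (T.product M).IsAttractor (A ×ˢ Set.univ) := by
  have hm : MeasurableSet (A ×ˢ (Set.univ : Set Q)) := hA.1.prod MeasurableSet.univ
  refine ⟨hm, fun μ hμ => ?_⟩
  refine (mem_ae_iff_prob_eq_one (measurableSet_eventually hm)).1 ?_
  filter_upwards [hA.ae_frequently_mem (T.product M) measurable_fst (T.map_fst_product_kernel M) μ]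
    with ρ hρ
  obtain ⟨n, hn⟩ := hρ.exists
  exact ⟨n, hn, Set.mem_univ _⟩

theorem IsRecurrentPath.inf_eq {a : S × Q} {ρ : ℕ → S × Q}
    (hρ : (T.product M).IsRecurrentPath a ρ) :
    (T.product M).inf ρ = {q | ∃ s, (T.product M).Reach a (s, q)} := by
  ext q
  have hq : q ∈ (T.product M).inf ρ ↔ ∃ᶠ n in atTop, (ρ n).2 = q := by
    rw [Nat.frequently_atTop_iff_infinite]
    simp [inf, product, eq_comm]
  rw [hq]
  constructor
  · intro h
    obtain ⟨n, hn⟩ := (hρ.2 a Relation.ReflTransGen.refl).exists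
    obtain ⟨m, hm, rfl⟩ := frequently_atTop.1 h n
    exact ⟨(ρ m).1, hn ▸ reach_of_le hρ.1 hm⟩
  · rintro ⟨s, hs⟩
    exact (hρ.2 _ hs).mono fun n hn => by rw [hn]

theorem IsRecurrentPath.isGood_iff {a : S × Q} {ρ : ℕ → S × Q}
    (hρ : (T.product M).IsRecurrentPath a ρ) {B : Set (S × Q)}
    (hne : ∃ b ∈ B, (T.product M).Reach a b) :
    T.IsGood M {x : B | (T.product M).Reach a x} ↔ ρ ∈ (T.product M).muller M.acc := by
  have hreach : ∀ s q, (∃ c ∈ {x : B | (T.product M).Reach a x}, (T.product M).Reach c (s, q)) ↔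
      (T.product M).Reach a (s, q) := by
    intro s q
    refine ⟨fun ⟨c, hc, h⟩ => Relation.ReflTransGen.trans hc h, fun h => ?_⟩
    obtain ⟨b, hb, hab⟩ := hne
    exact ⟨⟨b, hb⟩, hab, (hρ.reach_symm hab).trans h⟩
  rw [muller, Set.mem_ofPred_eq, hρ.inf_eq, IsGood]
  simp only [hreach]
  refine ⟨fun ⟨_, F, hF, h1, h2⟩ => ?_, fun h => ⟨hρ.isBSCC hne, _, h, fun s q hq => ⟨s, hq⟩,
    fun q hq => hq⟩⟩
  convert hF using 1
  exact Set.Subset.antisymm (fun q ⟨s, hs⟩ => h1 s q hs) h2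

end Product

end LSTS

theorem mainTheorem6 {S AP Q : Type*} [Countable S] [MeasurableSpace S] [DiscreteMeasurableSpace S]
    [Finite AP] [Finite Q] [MeasurableSpace Q] [DiscreteMeasurableSpace Q]
    (T : LSTS S AP) (M : DMA AP Q)
    (hT : ∃ A : Set S, A.Finite ∧ T.IsAttractor A) :
    (∃ B : Set (S × Q), B.Finite ∧ (T.product M).IsAttractor B) ∧
    ∀ B : Set (S × Q), (T.product M).IsAttractor B →
      ∀ μ : Measure S, IsProbabilityMeasure μ →
        (T.product M).prob (μ.prod (Measure.dirac M.init)) ((T.product M).muller M.acc) =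
          ∑' C : {C : Set B // T.IsGood M C},
            (T.product M).prob (μ.prod (Measure.dirac M.init))
              (LSTS.eventually (Subtype.val '' C.1)) := by
  obtain ⟨A, hAfin, hA⟩ := hT
  refine ⟨⟨A ×ˢ Set.univ, hAfin.prod Set.finite_univ, hA.prod_univ⟩, fun B hB μ hμ => ?_⟩
  set ν := μ.prod (Measure.dirac M.init)
  -- Recurrence is drawn from `A × Q`, because `B` may be infinite; `B` only has to be reachable
  -- from every state.
  have hrec : ∀ᵐ ρ ∂(T.product M).prob ν, ∃ a, (T.product M).IsRecurrentPath a ρ := by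
    refine (T.product M).ae_isRecurrentPath ν (A := A ×ˢ Set.univ) (hAfin.prod Set.finite_univ) ?_
    filter_upwards [hA.ae_frequently_mem (T.product M) measurable_fst
      (T.map_fst_product_kernel M) ν] with ρ hρ
    exact hρ.mono fun n hn => ⟨hn, Set.mem_univ _⟩
  have : Countable {C : Set B // T.IsGood M C} :=
    ((LSTS.countable_isBSCC ((T.product M).graph B)).mono fun C hC => hC.1).to_subtype
  rw [← measure_iUnion₀ (f := fun C : {C : Set B // T.IsGood M C} =>
    LSTS.eventually (Subtype.val '' C.1))]
  · refine measure_congr ?_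
    filter_upwards [hrec] with ρ ⟨a, hρ⟩
    have hne := hB.exists_reach a
    refine propext ((hρ.isGood_iff hne).symm.trans ?_)
    refine Iff.trans ⟨fun h => ?_, fun ⟨C, hC⟩ => ?_⟩ Set.mem_iUnion.symm
    · exact ⟨⟨_, h⟩, hρ.mem_eventually hne⟩
    · exact hρ.eq_of_mem_eventually hne C.2.1 hC ▸ C.2
  -- The events of two components need not be disjoint, but a recurrent path in both would force `C
  -- = D`, so they overlap in a null set.
  · intro C D hCD
    refine measure_mono_null (t := {ρ | ¬ ∃ a, (T.product M).IsRecurrentPath a ρ})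
      (fun ρ hmem hex => ?_) hrec
    obtain ⟨a, hρ⟩ := hex
    have hne := hB.exists_reach a
    exact hCD (Subtype.ext ((hρ.eq_of_mem_eventually hne C.2.1 hmem.1).trans
      (hρ.eq_of_mem_eventually hne D.2.1 hmem.2).symm))
  · exact fun C => (LSTS.measurableSet_eventually
      (Set.to_countable _).measurableSet).nullMeasurableSet
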